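/- Theorem (Buchstaber and Rees). Let $K$ be a commutative ring containing $\mathbb{Q}$ (a commutative $\mathbb{Q}$-algebra, for example a field of characteristic zero), let $A$ and $B$ be commutative unital $K$-algebras, and let $n\ge 1$. For a $K$-linear map $\varphi\colon A\to B$ define the Frobenius maps by $\Phi_1(\varphi,a)=\varphi(a)$ and \[ \Phi_{k+1}(\varphi,a_1,\dots,a_{k+1})=\varphi(a_1)\,\Phi_k(\varphi,a_2,\dots,a_{k+1})-\sum_{i=2}^{k+1}\Phi_k(\varphi,a_2,\dots,a_1a_i,\dots,a_{k+1}). \] The map $\varphi$ is called an $n$-homomorphism if $\varphi(1)=n$ and $\Phi_{n+1}(\varphi,a_1,\dots,a_{n+1})=0$ for all $a_i\in A$. Let $S^n(A)\subset A^{\otimes n}$ (tensor product over $K$) be the subalgebra of tensors invariant under all permutations of the factors. (1) If $\varphi\colon A\to B$ is an $n$-homomorphism, then \[ F(a_1,\dots,a_n)=\frac{1}{n!}\,\Phi_n(\varphi,a_1,\dots,a_n) \] defines a $K$-algebra homomorphism $F\colon S^n(A)\to B$; that is, the restriction to $S^n(A)$ of the linear map $A^{\otimes n}\to B$ induced by the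 multilinear map $\frac1{n!}\Phi_n(\varphi,\cdot)$ is an algebra homomorphism, and its value at the symmetric tensor $\frac{1}{n!}\sum_{\sigma\in S_n}a_{\sigma(1)}\otimes\dots\otimes a_{\sigma(n)}$ is $\frac{1}{n!}\Phi_n(\varphi,a_1,\dots,a_n)$ for all $a_1,\dots,a_n\in A$. (2) If $F\colon S^n(A)\to B$ is a $K$-algebra homomorphism, then the linear map \[ \varphi(a)=F\bigl(a\otimes1\otimes\dots\otimes1+\dots+1\otimes\dots\otimes1\otimes a\bigr) \] is an $n$-homomorphism $A\to B$. (3) The constructions (1) and (2) are mutually inverse, so they give a bijection between the $n$-homomorphisms $A\to B$ and the $K$-algebra homomorphisms $S^n(A)\to B$. -/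

import Mathlib

open scoped TensorProduct

namespace BuchstaberRees

section

variable {K A B : Type*} [CommRing K] [CommRing A] [CommRing B] [Algebra K A] [Algebra K B]

/-- The Frobenius maps `Φ_k(φ, a₁, …, a_k)` of a linear map `φ : A → B`, by the recursion
`Φ_{k+1}(φ, a₁, …, a_{k+1}) = φ(a₁) Φ_k(φ, a₂, …, a_{k+1}) - Φ_k(φ, a₁a₂, a₃, …, a_{k+1}) - …
- Φ_k(φ, a₂, …, a_k, a₁a_{k+1})`. The recursion is started at `Φ₀ = 1`, which gives
`Φ₁(φ, a) = φ(a)`. -/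
def frobenius (φ : A →ₗ[K] B) : (k : ℕ) → (Fin k → A) → B
  | 0, _ => 1
  | k + 1, a => φ (a 0) * frobenius φ k (Fin.tail a)
      - ∑ i : Fin k,
          frobenius φ k (Function.update (Fin.tail a) i (a 0 * Fin.tail a i))

theorem frobenius_one (φ : A →ₗ[K] B) (a : Fin 1 → A) : frobenius φ 1 a = φ (a 0) := by
  simp [frobenius]

theorem frobenius_succ (φ : A →ₗ[K] B) (k : ℕ) (a : Fin (k + 1) → A) :
    frobenius φ (k + 1) a = φ (a 0) * frobenius φ k (Fin.tail a)
      - ∑ i : Fin k,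
          frobenius φ k (Function.update (Fin.tail a) i (a 0 * Fin.tail a i)) := rfl

theorem tail_update_zero {A : Type*} {k : ℕ} (m : Fin (k + 1) → A) (x : A) :
    Fin.tail (Function.update m 0 x) = Fin.tail m := by
  ext j
  simp [Fin.tail]

theorem tail_update_succ {A : Type*} {k : ℕ} (m : Fin (k + 1) → A) (j : Fin k) (x : A) :
    Fin.tail (Function.update m j.succ x) = Function.update (Fin.tail m) j x := by
  ext l
  by_cases h : l = j
  · subst h; simp [Fin.tail]
  · simp [Fin.tail, h]

/-- Updating the `j`-th entry before multiplying the `i`-th one by `c`. -/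
theorem update_mul_update {k : ℕ} (t : Fin k → A) (c x : A) (i j : Fin k) :
    Function.update (Function.update t j x) i (c * Function.update t j x i)
      = if i = j then Function.update t j (c * x)
        else Function.update (Function.update t i (c * t i)) j x := by
  split_ifs with h
  · subst h; simp
  · rw [Function.update_of_ne h, Function.update_comm (Ne.symm h)]

theorem frobenius_update_add (φ : A →ₗ[K] B) (k : ℕ) (m : Fin k → A) (j : Fin k) (x y : A) :
    frobenius φ k (Function.update m j (x + y))
      = frobenius φ k (Function.update m j x) + frobenius φ k (Function.update m j y) := by
  induction k generalizing x y with
  | zero => exact j.elim0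
  | succ k ih =>
    refine Fin.cases ?_ (fun j => ?_) j
    · simp only [frobenius_succ, tail_update_zero, Function.update_self, map_add, add_mul, ih,
        Finset.sum_add_distrib]
      ring
    · simp only [frobenius_succ, tail_update_succ, update_mul_update,
        Function.update_of_ne (Fin.succ_ne_zero j).symm]
      rw [ih, mul_add, ← add_sub_add_comm, ← Finset.sum_add_distrib]
      congr 1
      refine Finset.sum_congr rfl fun i _ => ?_
      split_ifs
      · rw [mul_add, ih]
      · rw [ih]

theorem frobenius_update_smul (φ : A →ₗ[K] B) (k : ℕ) (m : Fin k → A) (j : Fin k) (c : K)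
    (x : A) :
    frobenius φ k (Function.update m j (c • x)) = c • frobenius φ k (Function.update m j x) := by
  induction k generalizing x with
  | zero => exact j.elim0
  | succ k ih =>
    refine Fin.cases ?_ (fun j => ?_) j
    · simp only [frobenius_succ, tail_update_zero, Function.update_self, map_smul,
        smul_mul_assoc, ih, smul_sub, Finset.smul_sum]
    · simp only [frobenius_succ, tail_update_succ, update_mul_update,
        Function.update_of_ne (Fin.succ_ne_zero j).symm]
      rw [ih, smul_sub, Finset.smul_sum, mul_smul_comm]
      congr 1
      refine Finset.sum_congr rfl fun i _ => ?_
      split_ifs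
      · rw [mul_smul_comm, ih]
      · rw [ih]

/-- `Φ_k(φ, ·)` as a multilinear map. -/
def frobeniusMultilinear (φ : A →ₗ[K] B) (k : ℕ) :
    MultilinearMap K (fun _ : Fin k => A) B where
  toFun := frobenius φ k
  map_update_add' m i x y := by
    convert frobenius_update_add φ k m i x y
  map_update_smul' m i c x := by
    convert frobenius_update_smul φ k m i c x

/-- `φ` is an `n`-homomorphism: `φ(1) = n` and `Φ_{n+1}(φ, a₁, …, a_{n+1}) = 0` identically. -/
def IsNHom (n : ℕ) (φ : A →ₗ[K] B) : Prop :=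
  φ 1 = (n : B) ∧ ∀ a : Fin (n + 1) → A, frobenius φ (n + 1) a = 0

end

section

variable (K A : Type*) [CommRing K] [CommRing A] [Algebra K A] (n : ℕ)

/-- The permutation action of `σ` on `A ⊗ ⋯ ⊗ A` (`n` factors). -/
noncomputable def perm (σ : Equiv.Perm (Fin n)) :
    (⨂[K] _ : Fin n, A) →ₗ[K] (⨂[K] _ : Fin n, A) :=
  (PiTensorProduct.reindex K (fun _ : Fin n => A) σ).toLinearMap

theorem perm_tprod (σ : Equiv.Perm (Fin n)) (a : Fin n → A) :
    perm K A n σ (PiTensorProduct.tprod K a)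
      = PiTensorProduct.tprod K (fun i => a (σ.symm i)) :=
  PiTensorProduct.reindex_tprod σ a

theorem perm_mul (σ : Equiv.Perm (Fin n)) (x y : ⨂[K] _ : Fin n, A) :
    perm K A n σ (x * y) = perm K A n σ x * perm K A n σ y := by
  induction x using PiTensorProduct.induction_on with
  | smul_tprod r a =>
    induction y using PiTensorProduct.induction_on with
    | smul_tprod s b =>
      simp only [map_smul, smul_mul_assoc, mul_smul_comm, PiTensorProduct.tprod_mul_tprod,
        perm_tprod]
      rfl
    | add y z hy hz => simp only [mul_add, map_add, hy, hz]
  | add x z hx hz => simp only [add_mul, map_add, hx, hz]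

/-- `S^n(A)`: the subalgebra of `A ⊗ ⋯ ⊗ A` (`n` factors) of the symmetric tensors, that is of
those fixed by all permutations of the factors. -/
noncomputable def symTensors : Subalgebra K (⨂[K] _ : Fin n, A) where
  carrier := {x | ∀ σ : Equiv.Perm (Fin n), perm K A n σ x = x}
  mul_mem' {x y} hx hy σ := by rw [perm_mul, hx σ, hy σ]
  add_mem' {x y} hx hy σ := by rw [map_add, hx σ, hy σ]
  algebraMap_mem' r σ := by
    rw [Algebra.algebraMap_eq_smul_one, map_smul, PiTensorProduct.one_def, perm_tprod]
    rfl

variable {A}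

/-- `a ⊗ 1 ⊗ ⋯ ⊗ 1 + 1 ⊗ a ⊗ 1 ⊗ ⋯ ⊗ 1 + ⋯ + 1 ⊗ ⋯ ⊗ 1 ⊗ a`, an element of `S^n(A)`. -/
noncomputable def placeSum (a : A) : symTensors K A n :=
  ⟨∑ i : Fin n, PiTensorProduct.tprod K (Function.update (fun _ : Fin n => (1 : A)) i a), by
    intro σ
    rw [map_sum, ← Equiv.sum_comp σ (fun i : Fin n =>
      PiTensorProduct.tprod K (Function.update (fun _ : Fin n => (1 : A)) i a))]
    refine Finset.sum_congr rfl fun i _ => ?_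
    rw [perm_tprod]
    congr 1
    ext j
    simp only [Function.update_apply, Equiv.symm_apply_eq]⟩

/-- The scalar `1 / n!` of a `ℚ`-algebra `K`. -/
noncomputable def invFactorial [Algebra ℚ K] : K := algebraMap ℚ K (1 / (n.factorial : ℚ))

/-- The symmetric tensor `(1 / n!) ∑_σ a_{σ(1)} ⊗ ⋯ ⊗ a_{σ(n)}`. A linear map on `S^n(A)` is
written as a symmetric multilinear function of `a₁, …, a_n` by evaluating it here. -/
noncomputable def symProd [Algebra ℚ K] (a : Fin n → A) : symTensors K A n :=
  ⟨invFactorial K n • ∑ σ : Equiv.Perm (Fin n), PiTensorProduct.tprod K (fun i => a (σ i)), by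
    intro τ
    rw [map_smul, map_sum, ← Equiv.sum_comp (Equiv.mulRight τ⁻¹)
      (fun σ : Equiv.Perm (Fin n) => PiTensorProduct.tprod K (fun i => a (σ i)))]
    congr 1
    refine Finset.sum_congr rfl fun σ _ => ?_
    rw [perm_tprod]
    rfl⟩

end

end BuchstaberRees

namespace BuchstaberRees

/-! ### Frobenius maps and algebra homomorphisms. -/

section

variable {K A B C : Type*} [CommRing K] [CommRing A] [CommRing B] [CommRing C]
  [Algebra K A] [Algebra K B] [Algebra K C]

/-! The map `placeSumLinear`, written δ, is the universal `n`-homomorphism. Inside the tensor power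
it is the sum of the `n` coordinate embeddings, so `frobenius_sum_algHom` expresses Φ_k(δ) as a sum
over injections `Fin k → Fin n`. There are none for k = n + 1, so δ and every F ∘ δ are
`n`-homomorphisms. For k = n they are the permutations, so each `symProd` is a polynomial in values
of δ; averaging shows that these values generate S^n(A) (`adjoin_range_placeSum`). Conversely,
Φ_{n+1}(φ) = 0 says exactly that L = Φ_n(φ) satisfies L(x δ(a)) = L(x) φ(a)
(`lift_frobenius_mul_placeSum`). As L(1) = n!, the map F = L / n! is unital with F ∘ δ = φ, and it
is multiplicative because the δ(a) generate. Generation also makes the two constructions mutually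
inverse. -/

theorem frobenius_comp_algHom (F : C →ₐ[K] B) (φ : A →ₗ[K] C) (k : ℕ) (a : Fin k → A) :
    frobenius (F.toLinearMap ∘ₗ φ) k a = F (frobenius φ k a) := by
  induction k with
  | zero => simp [frobenius]
  | succ k ih => simp [frobenius_succ, ih]

theorem frobenius_mem_adjoin (φ : A →ₗ[K] B) (k : ℕ) (a : Fin k → A) :
    frobenius φ k a ∈ Algebra.adjoin K (Set.range φ) := by
  induction k with
  | zero => exact one_mem _
  | succ k ih =>
    exact sub_mem (mul_mem (Algebra.subset_adjoin ⟨_, rfl⟩) (ih _)) (sum_mem fun _ _ => ih _)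

theorem frobenius_ones (φ : A →ₗ[K] B) (n : ℕ) (hφ : φ 1 = n) {k : ℕ} (hk : k ≤ n) :
    frobenius φ k (fun _ => 1) = (n.descFactorial k : B) := by
  induction k with
  | zero => simp [frobenius]
  | succ k ih =>
    have htail : Fin.tail (fun _ : Fin (k + 1) => (1 : A)) = fun _ => 1 := rfl
    rw [frobenius_succ, htail]
    simp only [one_mul, Function.update_eq_self_iff.2, ih (by omega), hφ, Finset.sum_const,
      Finset.card_univ, Fintype.card_fin, nsmul_eq_mul, Nat.descFactorial_succ, Nat.cast_mul,
      Nat.cast_sub (show k ≤ n by omega), sub_mul]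

/-- The Frobenius maps of a sum of algebra homomorphisms are sums over injective indexings. -/
theorem frobenius_sum_algHom {I : Type*} [Fintype I] [DecidableEq I] (ι : I → A →ₐ[K] C) (k : ℕ)
    (a : Fin k → A) :
    frobenius (∑ i, (ι i).toLinearMap) k a
      = ∑ f : Fin k → I with Function.Injective f, ∏ j, ι (f j) (a j) := by
  induction k with
  | zero =>
    rw [Finset.filter_true_of_mem fun f _ => Function.injective_of_subsingleton f]
    simp [frobenius]
  | succ k ih =>
    -- An injection on `Fin (k + 1)` is an injective tail `g` and a head outside its range. Summing
    -- over heads gives the full sum minus the values on the range, which match the subtracted terms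
    -- of the recursion by `hprod`.
    have hsplit (g : Fin k → I) (hg : Function.Injective g) :
        ∑ i, (if i ∉ Set.range g then ι i (a 0) else 0)
          = ∑ i, ι i (a 0) - ∑ j, ι (g j) (a 0) := by
      rw [eq_sub_iff_add_eq, ← Finset.sum_image (f := fun i => ι i (a 0)) hg.injOn,
        ← Finset.sum_filter]
      convert Finset.sum_filter_not_add_sum_filter Finset.univ (· ∈ Set.range g) _ using 3
      ext i
      simp
    have hprod (g : Fin k → I) (j : Fin k) :
        ∏ l, ι (g l) (Function.update (Fin.tail a) j (a 0 * Fin.tail a j) l)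
          = ι (g j) (a 0) * ∏ l, ι (g l) (Fin.tail a l) := by
      rw [← Finset.mul_prod_erase _ _ (Finset.mem_univ j),
        ← Finset.mul_prod_erase _ (fun l => ι (g l) (Fin.tail a l)) (Finset.mem_univ j),
        Function.update_self, map_mul, mul_assoc]
      congr 2
      refine Finset.prod_congr rfl fun l hl => ?_
      rw [Function.update_of_ne (Finset.ne_of_mem_erase hl)]
    have hcons (i : I) (g : Fin k → I) :
        Function.Injective (Fin.consEquiv (fun _ : Fin (k + 1) => I) (i, g))
          ↔ i ∉ Set.range g ∧ Function.Injective g := Fin.cons_injective_iff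
    rw [frobenius_succ]
    simp only [ih, hprod]
    rw [Finset.sum_comm, Finset.mul_sum, ← Finset.sum_sub_distrib, Finset.sum_filter,
      Finset.sum_filter, ← Equiv.sum_comp (Fin.consEquiv fun _ : Fin (k + 1) => I),
      Fintype.sum_prod_type_right]
    refine Finset.sum_congr rfl fun g _ => ?_
    by_cases hg : Function.Injective g
    · simp only [hcons, hg, and_true,
        Fin.consEquiv_apply, Fin.prod_univ_succ, Fin.cons_zero, Fin.cons_succ]
      rw [← Finset.sum_mul, LinearMap.sum_apply, ← sub_mul]
      simp only [AlgHom.toLinearMap_apply]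
      rw [← hsplit g hg, Finset.sum_mul]
      refine Finset.sum_congr rfl fun i _ => ?_
      rw [ite_mul, zero_mul]
      rfl
    · simp [hcons, hg]

end

/-! ### Generators of the algebra of symmetric tensors. -/

section

variable (K : Type*) {A B : Type*} [CommRing K] [CommRing A] [Algebra K A] [CommRing B]
  [Algebra K B] (n : ℕ)

theorem singleAlgHom_eq_tprod_update (i : Fin n) (a : A) :
    PiTensorProduct.singleAlgHom (R := K) (A := fun _ : Fin n => A) i a
      = PiTensorProduct.tprod K (Function.update (fun _ : Fin n => (1 : A)) i a) := by
  rfl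

/-- `placeSum` as a linear map. -/
noncomputable def placeSumLinear : A →ₗ[K] symTensors K A n where
  toFun := placeSum K n
  map_add' a b := by
    ext
    simp [placeSum, Finset.sum_add_distrib]
  map_smul' c a := by
    ext
    simp [placeSum, Finset.smul_sum]

theorem val_comp_placeSumLinear :
    (symTensors K A n).val.toLinearMap ∘ₗ placeSumLinear K n
      = ∑ i, (PiTensorProduct.singleAlgHom (R := K) (A := fun _ : Fin n => A) i).toLinearMap := by
  ext a
  simp only [LinearMap.sum_apply, AlgHom.toLinearMap_apply, singleAlgHom_eq_tprod_update]
  rfl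

theorem prod_singleAlgHom_perm (σ : Equiv.Perm (Fin n)) (a : Fin n → A) :
    ∏ j, PiTensorProduct.singleAlgHom (R := K) (A := fun _ : Fin n => A) (σ j) (a j)
      = PiTensorProduct.tprod K (fun i => a (σ.symm i)) := by
  simp only [singleAlgHom_eq_tprod_update]
  rw [← PiTensorProduct.tprod_prod]
  congr 1
  ext i
  rw [Finset.prod_apply, Finset.prod_eq_single (σ.symm i)]
  · simp
  · intro j _ hj
    rw [Function.update_of_ne]
    rintro rfl
    simp at hj
  · simp

theorem isNHom_placeSumLinear : IsNHom n (placeSumLinear K n (A := A)) := by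
  constructor
  · apply Subtype.val_injective
    change ∑ i : Fin n, PiTensorProduct.tprod K (Function.update (fun _ => (1 : A)) i 1) = n
    simp only [Function.update_eq_self_iff.2, Finset.sum_const, Finset.card_univ,
      Fintype.card_fin]
    exact nsmul_one n
  · intro a
    apply Subtype.val_injective
    have := frobenius_comp_algHom (symTensors K A n).val (placeSumLinear K n) (n + 1) a
    rw [val_comp_placeSumLinear, frobenius_sum_algHom, Finset.filter_false_of_mem] at this
    · exact this.symm
    · intro f _ hf
      simpa using Fintype.card_le_of_injective f hf

theorem IsNHom.algHom_comp {C : Type*} [CommRing C] [Algebra K C] {φ : A →ₗ[K] C} {n : ℕ}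
    (h : IsNHom n φ) (F : C →ₐ[K] B) : IsNHom n (F.toLinearMap ∘ₗ φ) :=
  ⟨by simp [h.1], fun a => by rw [frobenius_comp_algHom, h.2, map_zero]⟩

-- Multiplying b₁ ⊗ ⋯ ⊗ b_n by the place sum of `a` inserts `a` into each slot in turn, which yields
-- the subtracted terms in the recursion for Φ_{n+1}(a, b₁, …, b_n) = 0. This works for all tensors,
-- so symmetry of Φ_n is never needed.
variable {K n} in
theorem lift_frobenius_mul_placeSum {φ : A →ₗ[K] B} (h : IsNHom n φ)
    (x : ⨂[K] _ : Fin n, A) (a : A) :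
    PiTensorProduct.lift (frobeniusMultilinear φ n) (x * placeSum K n a)
      = PiTensorProduct.lift (frobeniusMultilinear φ n) x * φ a := by
  induction x using PiTensorProduct.induction_on with
  | smul_tprod r b =>
    have hrec := h.2 (Fin.cons a b)
    rw [frobenius_succ, sub_eq_zero, Fin.tail_cons, Fin.cons_zero] at hrec
    have hmul (i : Fin n) : b * Function.update (fun _ => 1) i a
        = Function.update b i (a * b i) := by
      ext j
      rcases eq_or_ne j i with rfl | hj
      · simp [mul_comm]
      · simp [hj]
    simp only [placeSum, Finset.mul_sum, smul_mul_assoc, PiTensorProduct.tprod_mul_tprod, hmul,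
      map_sum, map_smul, PiTensorProduct.lift.tprod]
    rw [← Finset.smul_sum]
    congr 1
    rw [mul_comm]
    exact hrec.symm
  | add x z hx hz => simp only [add_mul, map_add, hx, hz]

variable [Algebra ℚ K]

theorem invFactorial_mul_factorial : invFactorial K n * (n.factorial : K) = 1 := by
  rw [invFactorial, ← map_natCast (algebraMap ℚ K), ← map_mul,
    one_div_mul_cancel (by positivity), map_one]

theorem symProd_eq_frobenius (a : Fin n → A) :
    symProd K n a = invFactorial K n • frobenius (placeSumLinear K n) n a := by
  apply Subtype.val_injective
  have := frobenius_comp_algHom (symTensors K A n).val (placeSumLinear K n) n a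
  rw [val_comp_placeSumLinear, frobenius_sum_algHom] at this
  change _ = invFactorial K n • (symTensors K A n).val (frobenius (placeSumLinear K n) n a)
  rw [← this]
  change invFactorial K n • _ = _
  congr 1
  -- Sending `a j` to place `σ j` puts `a (σ⁻¹ i)` at place `i`, hence the reindexing by inverses.
  rw [← Equiv.sum_comp (Equiv.inv (Equiv.Perm (Fin n)))]
  refine Finset.sum_bij (fun σ _ => σ) (by simp [Equiv.injective])
    (fun σ _ τ _ h => DFunLike.coe_injective h) (fun f hf => ?_) (fun σ _ => ?_)
  · have hf := Finite.injective_iff_bijective.1 (Finset.mem_filter.1 hf).2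
    exact ⟨Equiv.ofBijective f hf, Finset.mem_univ _, rfl⟩
  · rw [prod_singleAlgHom_perm]
    rfl

theorem symProd_mem_adjoin (a : Fin n → A) :
    symProd K n a ∈ Algebra.adjoin K (Set.range (placeSum K n (A := A))) := by
  have h := frobenius_mem_adjoin (placeSumLinear K n) n a
  have hrange : Set.range (placeSumLinear K n (A := A)) = Set.range (placeSum K n) := rfl
  rw [hrange] at h
  rw [symProd_eq_frobenius]
  exact Subalgebra.smul_mem _ h (invFactorial K n)

theorem val_symProd (a : Fin n → A) :
    (symProd K n a : ⨂[K] _ : Fin n, A)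
      = invFactorial K n • ∑ σ, perm K A n σ (PiTensorProduct.tprod K a) := by
  rw [← Equiv.sum_comp (Equiv.inv (Equiv.Perm (Fin n)))]
  simp only [perm_tprod]
  rfl

/-- Averages of tensors over all permutations are polynomials in the `placeSum`s. -/
theorem exists_adjoin_eq_average (x : ⨂[K] _ : Fin n, A) :
    ∃ y ∈ Algebra.adjoin K (Set.range (placeSum K n (A := A))),
      (y : ⨂[K] _ : Fin n, A) = invFactorial K n • ∑ σ, perm K A n σ x := by
  induction x using PiTensorProduct.induction_on with
  | smul_tprod r a =>
    refine ⟨r • symProd K n a, Subalgebra.smul_mem _ (symProd_mem_adjoin K n a) r, ?_⟩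
    rw [Subalgebra.coe_smul, val_symProd, smul_comm, Finset.smul_sum]
    simp only [map_smul]
  | add x z hx hz =>
    obtain ⟨y, hy, hyx⟩ := hx
    obtain ⟨w, hw, hwz⟩ := hz
    refine ⟨y + w, add_mem hy hw, ?_⟩
    simp only [Subalgebra.coe_add, hyx, hwz, map_add, Finset.sum_add_distrib, smul_add]

/-- A symmetric tensor equals its own average over permutations. -/
theorem adjoin_range_placeSum :
    Algebra.adjoin K (Set.range (placeSum K n (A := A))) = ⊤ := by
  rw [eq_top_iff]
  intro x _
  obtain ⟨y, hy, hyx⟩ := exists_adjoin_eq_average K n (x : ⨂[K] _ : Fin n, A)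
  rw [Finset.sum_congr rfl fun σ _ => x.2 σ, Finset.sum_const, Finset.card_univ,
    Fintype.card_perm, Fintype.card_fin, ← Nat.cast_smul_eq_nsmul K, smul_smul,
    invFactorial_mul_factorial, one_smul] at hyx
  rwa [← Subtype.val_injective hyx]

/-! ### The algebra homomorphism of an `n`-homomorphism. -/

variable {K n}

/-- The linear map `F = (1 / n!) Φ_n` on symmetric tensors. -/
noncomputable def symFrobenius (φ : A →ₗ[K] B) (n : ℕ) : symTensors K A n →ₗ[K] B :=
  invFactorial K n • PiTensorProduct.lift (frobeniusMultilinear φ n) ∘ₗ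
    (symTensors K A n).val.toLinearMap

theorem symFrobenius_mul_placeSum {φ : A →ₗ[K] B} (h : IsNHom n φ) (x : symTensors K A n)
    (a : A) : symFrobenius φ n (x * placeSum K n a) = symFrobenius φ n x * φ a := by
  change invFactorial K n •
      PiTensorProduct.lift (frobeniusMultilinear φ n) ((x : ⨂[K] _ : Fin n, A) * placeSum K n a)
    = (invFactorial K n •
      PiTensorProduct.lift (frobeniusMultilinear φ n) (x : ⨂[K] _ : Fin n, A)) * φ a
  rw [lift_frobenius_mul_placeSum h, smul_mul_assoc]

theorem symFrobenius_one {φ : A →ₗ[K] B} (h : IsNHom n φ) : symFrobenius φ n 1 = 1 := by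
  change invFactorial K n • PiTensorProduct.lift (frobeniusMultilinear φ n) (1 : ⨂[K] _ : Fin n, A) = 1
  rw [PiTensorProduct.one_def, PiTensorProduct.lift.tprod]
  change invFactorial K n • frobenius φ n (fun _ => 1) = 1
  rw [frobenius_ones φ n h.1 le_rfl, Nat.descFactorial_self, ← nsmul_one,
    ← Nat.cast_smul_eq_nsmul K (M := B), smul_smul, invFactorial_mul_factorial, one_smul]

theorem symFrobenius_placeSum {φ : A →ₗ[K] B} (h : IsNHom n φ) (a : A) :
    symFrobenius φ n (placeSum K n a) = φ a := by
  rw [← one_mul (placeSum K n a), symFrobenius_mul_placeSum h, symFrobenius_one h, one_mul]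

theorem symFrobenius_mul {φ : A →ₗ[K] B} (h : IsNHom n φ) (x y : symTensors K A n) :
    symFrobenius φ n (x * y) = symFrobenius φ n x * symFrobenius φ n y := by
  have hy : y ∈ Algebra.adjoin K (Set.range (placeSum K n (A := A))) := by
    rw [adjoin_range_placeSum]; trivial
  -- The product case applies the hypothesis for its last factor `z` to both `x * y` and `y`, so `x`
  -- must vary.
  induction hy using Algebra.adjoin_induction generalizing x with
  | mem y hy =>
    obtain ⟨a, rfl⟩ := hy
    rw [symFrobenius_mul_placeSum h, symFrobenius_placeSum h]
  | algebraMap r =>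
    rw [Algebra.algebraMap_eq_smul_one, mul_smul_comm, mul_one, map_smul, map_smul,
      symFrobenius_one h, mul_smul_comm, mul_one]
  | add y z _ _ hy hz => rw [mul_add, map_add, hy, hz, map_add, mul_add]
  | mul y z _ _ hy hz => rw [← mul_assoc, hz, hy, hz y, mul_assoc]

/-- The algebra homomorphism on symmetric tensors given by an `n`-homomorphism. -/
noncomputable def symFrobeniusAlgHom {φ : A →ₗ[K] B} (h : IsNHom n φ) :
    symTensors K A n →ₐ[K] B :=
  AlgHom.ofLinearMap (symFrobenius φ n) (symFrobenius_one h) (symFrobenius_mul h)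

theorem symFrobeniusAlgHom_comp_placeSumLinear {φ : A →ₗ[K] B} (h : IsNHom n φ) :
    (symFrobeniusAlgHom h).toLinearMap ∘ₗ placeSumLinear K n = φ :=
  LinearMap.ext (symFrobenius_placeSum h)

theorem symFrobeniusAlgHom_symProd {φ : A →ₗ[K] B} (h : IsNHom n φ) (a : Fin n → A) :
    symFrobeniusAlgHom h (symProd K n a) = invFactorial K n • frobenius φ n a := by
  rw [symProd_eq_frobenius, map_smul, ← frobenius_comp_algHom,
    symFrobeniusAlgHom_comp_placeSumLinear]

variable (K A B n) in
/-- The correspondence of `n`-homomorphisms and algebra homomorphisms on symmetric tensors. -/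
noncomputable def nHomEquiv :
    {φ : A →ₗ[K] B // IsNHom n φ} ≃ (symTensors K A n →ₐ[K] B) where
  toFun φ := symFrobeniusAlgHom φ.2
  invFun F := ⟨F.toLinearMap ∘ₗ placeSumLinear K n, (isNHom_placeSumLinear K n).algHom_comp K F⟩
  left_inv φ := Subtype.ext (symFrobeniusAlgHom_comp_placeSumLinear φ.2)
  right_inv F := by
    refine AlgHom.ext_of_adjoin_eq_top (adjoin_range_placeSum K n) ?_
    rintro _ ⟨a, rfl⟩
    exact symFrobenius_placeSum ((isNHom_placeSumLinear K n).algHom_comp K F) a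

end

end BuchstaberRees

open BuchstaberRees in
theorem mainTheorem3 (K A B : Type*) [CommRing K] [Algebra ℚ K]
    [CommRing A] [Algebra K A] [CommRing B] [Algebra K B] (n : ℕ) (hn : 1 ≤ n) :
    ∃ e : {φ : A →ₗ[K] B // IsNHom n φ} ≃ (symTensors K A n →ₐ[K] B),
      (∀ (φ : {φ : A →ₗ[K] B // IsNHom n φ}) (a : Fin n → A),
        e φ (symProd K n a) = invFactorial K n • frobenius φ.1 n a) ∧
      (∀ (φ : {φ : A →ₗ[K] B // IsNHom n φ}) (x : symTensors K A n),
        e φ x = invFactorial K n •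
          PiTensorProduct.lift (frobeniusMultilinear φ.1 n) (x : ⨂[K] _ : Fin n, A)) ∧
      (∀ (F : symTensors K A n →ₐ[K] B) (a : A), (e.symm F).1 a = F (placeSum K n a)) :=
  ⟨nHomEquiv K A B n, fun φ a => symFrobeniusAlgHom_symProd φ.2 a, fun _ _ => rfl,
    fun _ _ => rfl⟩
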